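/- Let $f=(f_1,f_2)$ be an endomorphism of the affine plane $\mathbb{A}^2$ defined over $\mathbb{Z}$, that is, $f_1,f_2\in\mathbb{Z}[x_1,x_2]$ are arbitrary polynomials, and let $f$ act on $\mathbb{A}^2(\mathbb{Z})=\mathbb{Z}^2$ by $f(P)=(f_1(P),f_2(P))$. Let $P\in\mathbb{Z}^2$ be a periodic point of $f$, i.e. $f^n(P)=P$ for some integer $n\geq 1$, where $f^n$ denotes the $n$-th iterate. Then the orbit $\mathcal{O}_f(P)=\{f^k(P):k\geq 0\}$ has at most $24$ elements. -/

import Mathlib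

/-- An endomorphism of affine `N`-space over `R`, given by its `N` coordinate polynomials. -/
abbrev AffineEndo (N : ℕ) (R : Type*) [CommRing R] : Type _ :=
  Fin N → MvPolynomial (Fin N) R

/-- The self-map of the set of `R`-points of affine `N`-space (identified with `Fin N → R`)
induced by an endomorphism. -/
noncomputable def AffineEndo.onPoints {N : ℕ} {R : Type*} [CommRing R] (f : AffineEndo N R) :
    (Fin N → R) → (Fin N → R) :=
  fun P i => MvPolynomial.eval P (f i)

/-- The forward orbit `{P, g P, g (g P), …}` of a point under a self-map. -/
def forwardOrbit {X : Type*} (g : X → X) (P : X) : Set X :=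
  Set.range fun n : ℕ => g^[n] P

/-! There are four residue classes modulo `2`, so some `F = f^m` with `m ≤ 4` fixes `P` modulo `2`.
It remains to show `F^4 P = P` or `F^6 P = P`, since `4 * 6 = 24`. Let `A` be the Jacobian of `F` at
`P`. By Cayley–Hamilton, modulo `2` either `A^3 = A^2`, `A^2 = 1` or `A^2 + A + 1 = 0`. Respectively
`G = F^2, F^4, F^3` fixes `P` modulo `4` with derivative idempotent modulo `2`; then `G^2` has
derivative idempotent modulo `4`, and `fixed_of_periodic` gives `G^2 P = P`. When `A^2 = 1` this
yields only `F^8 P = P`. The Hessian modulo `2` is alternating, which forces any displacement of `P`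
under `F^4` to be too divisible by `2`, so `F^4 P = P`. -/

/-- A self-map of a `ℤ`-module lies in this class when it preserves the coset `P + 4V` and is,
at every scale `2 ^ (e + 2)`, affine with linear part `A` up to a relative error `4`. -/
def AffineModFour {V : Type*} [AddCommGroup V] (P : V) (A : Module.End ℤ V) (K : V → V) : Prop :=
  (∀ v, ∃ w, K (P + (4 : ℤ) • v) = P + (4 : ℤ) • w) ∧
    ∀ (e : ℕ) (v u : V), ∃ w, K (P + (4 : ℤ) • v + (2 : ℤ) ^ (e + 2) • u) =
      K (P + (4 : ℤ) • v) + (2 : ℤ) ^ (e + 2) • (A u + (4 : ℤ) • w)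

namespace AffineModFour

variable {V : Type*} [AddCommGroup V] {P : V} {A B : Module.End ℤ V} {K L : V → V}

theorem id : AffineModFour P (1 : Module.End ℤ V) _root_.id :=
  ⟨fun v => ⟨v, rfl⟩, fun e v u => ⟨0, by simp⟩⟩

theorem comp (hK : AffineModFour P A K) (hL : AffineModFour P B L) :
    AffineModFour P (A * B) (K ∘ L) := by
  refine ⟨fun v => ?_, fun e v u => ?_⟩
  · obtain ⟨w, hw⟩ := hL.1 v
    obtain ⟨w', hw'⟩ := hK.1 w
    exact ⟨w', by simp [hw, hw']⟩
  · obtain ⟨v', hv'⟩ := hL.1 v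
    obtain ⟨w, hw⟩ := hL.2 e v u
    obtain ⟨w', hw'⟩ := hK.2 e v' (B u + (4 : ℤ) • w)
    refine ⟨A w + w', ?_⟩
    simp only [Function.comp_apply, hw, hv', hw', map_add, map_smul, Module.End.mul_apply]
    module

theorem iterate (hK : AffineModFour P A K) (n : ℕ) : AffineModFour P (A ^ n) K^[n] := by
  induction n with
  | zero => exact id
  | succ n ih => rw [pow_succ, Function.iterate_succ]; exact ih.comp hK

theorem congr_linear (hK : AffineModFour P A K) {W : Module.End ℤ V}
    (h : B = A + (4 : ℤ) • W) : AffineModFour P B K := by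
  refine ⟨hK.1, fun e v u => ?_⟩
  obtain ⟨w, hw⟩ := hK.2 e v u
  refine ⟨w - W u, ?_⟩
  rw [hw, h]
  simp only [LinearMap.add_apply, LinearMap.smul_apply]
  module

theorem orbit_mem (hK : AffineModFour P A K) (n : ℕ) : ∃ v, K^[n] P = P + (4 : ℤ) • v := by
  simpa using (hK.iterate n).1 0

end AffineModFour

/-! ### Periodic points when the linear part is idempotent modulo `4`. -/

/-- A nonzero vector of `ℤ ^ ι` is a power of two times a vector that is not even. -/
theorem exists_two_pow_smul_odd {ι : Type*} {d : ι → ℤ} (hd : d ≠ 0) :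
    ∃ (e : ℕ) (a : ι → ℤ), d = (2 : ℤ) ^ e • a ∧ ∃ i, ¬ (2 : ℤ) ∣ a i := by
  classical
  obtain ⟨j, hj⟩ := Function.ne_iff.mp hd
  have hfin : ∃ e : ℕ, ¬ ∀ i, (2 : ℤ) ^ e ∣ d i := by
    obtain ⟨n, hn⟩ := (Int.finiteMultiplicity_iff (a := 2) (b := d j)).2 ⟨by norm_num, hj⟩
    exact ⟨n + 1, fun h => hn (h j)⟩
  have hspec := Nat.find_spec hfin
  obtain ⟨e, he⟩ : ∃ e, Nat.find hfin = e + 1 := by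
    refine Nat.exists_eq_succ_of_ne_zero fun h0 => hspec fun i => ?_
    rw [h0, pow_zero]
    exact one_dvd _
  have hdvd : ∀ i, (2 : ℤ) ^ e ∣ d i := not_not.1 (Nat.find_min hfin (by omega : e < _))
  choose a ha using hdvd
  refine ⟨e, a, funext fun i => by simp [ha i], ?_⟩
  by_contra! hall
  refine hspec fun i => ?_
  rw [he, ha i, pow_succ]
  exact mul_dvd_mul_left _ (hall i)

theorem two_pow_smul_cancel {ι : Type*} {e : ℕ} {a b : ι → ℤ}
    (h : (2 : ℤ) ^ e • a = (2 : ℤ) ^ e • b) : a = b :=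
  smul_right_injective _ (pow_ne_zero e two_ne_zero) h

namespace AffineModFour

variable {ι : Type*} {P : ι → ℤ} {A : Module.End ℤ (ι → ℤ)} {K : (ι → ℤ) → ι → ℤ}

/-- The displacement of a moved point is `2 ^ (e + 2)` times a vector that is not even. -/
theorem exists_displacement (hK : AffineModFour P A K) (hne : K P ≠ P) :
    ∃ (e : ℕ) (a : ι → ℤ), K P = P + (2 : ℤ) ^ (e + 2) • a ∧ ∃ i, ¬ (2 : ℤ) ∣ a i := by
  obtain ⟨v, hv⟩ := hK.1 0
  rw [smul_zero, add_zero] at hv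
  have hv0 : v ≠ 0 := by rintro rfl; simp at hv; exact hne hv
  obtain ⟨e, a, rfl, ha⟩ := exists_two_pow_smul_odd hv0
  refine ⟨e, a, ?_, ha⟩
  rw [hv]
  module

/-- Consecutive displacements, scaled by `2 ^ (e + 2)`, are multiplied by `A` modulo `4`. On a cycle
they are all congruent to the first, `a`, so `s • a` vanishes modulo `4` although `a` is not even.
-/
theorem four_dvd_of_iterate_eq (hK : AffineModFour P A K) {W : Module.End ℤ (ι → ℤ)}
    (hA : A * A = A + (4 : ℤ) • W) (hne : K P ≠ P) {s : ℕ} (hs : K^[s] P = P) : 4 ∣ s := by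
  obtain ⟨e, a, ha, i, hi⟩ := hK.exists_displacement hne
  rcases Nat.eq_zero_or_pos s with rfl | hpos
  · simp
  have hstep : ∀ n, ∃ b, K^[n + 1] P = K^[n] P + (2 : ℤ) ^ (e + 2) • b := by
    intro n
    induction n with
    | zero => exact ⟨a, ha⟩
    | succ n ih =>
      obtain ⟨b, hb⟩ := ih
      obtain ⟨v, hv⟩ := hK.orbit_mem n
      obtain ⟨w, hw⟩ := hK.2 e v b
      refine ⟨A b + (4 : ℤ) • w, ?_⟩
      rw [Function.iterate_succ_apply' K (n + 1), hb, hv, hw, ← hv,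
        ← Function.iterate_succ_apply' K n, hb]
  choose b hb using hstep
  have hlin : ∀ n, ∃ w, b (n + 1) = A (b n) + (4 : ℤ) • w := by
    intro n
    obtain ⟨v, hv⟩ := hK.orbit_mem n
    obtain ⟨w, hw⟩ := hK.2 e v (b n)
    refine ⟨w, two_pow_smul_cancel (e := e + 2) (add_left_cancel (a := K^[n + 1] P) ?_)⟩
    rw [← hb, Function.iterate_succ_apply' K (n + 1), hb n, hv, hw, ← hv,
      ← Function.iterate_succ_apply' K n, hb]
  have hb0 : b s = b 0 := by
    refine two_pow_smul_cancel (e := e + 2) (add_left_cancel (a := P) ?_)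
    have h1 := hb s
    have h2 := hb 0
    rw [Function.iterate_succ_apply', hs] at h1
    simp only [zero_add, Function.iterate_one, Function.iterate_zero, id_eq] at h2
    rw [← h1, ← h2]
  -- Closing the cycle puts `b 0` in the image of `A` modulo `4`, where an idempotent acts as the
  -- identity.
  have hfix : ∃ w, A (b 0) = b 0 + (4 : ℤ) • w := by
    obtain ⟨r, rfl⟩ := Nat.exists_eq_succ_of_ne_zero hpos.ne'
    obtain ⟨w, hw⟩ := hlin r
    rw [Nat.succ_eq_add_one] at hb0
    refine ⟨W (b r) + A w - w, ?_⟩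
    have hAA : A (A (b r)) = A (b r) + (4 : ℤ) • W (b r) := by
      simpa using LinearMap.congr_fun hA (b r)
    rw [← hb0, hw, map_add, map_smul, hAA]
    module
  obtain ⟨w₀, hw₀⟩ := hfix
  have hconst : ∀ n, ∃ w, b n = b 0 + (4 : ℤ) • w := by
    intro n
    induction n with
    | zero => exact ⟨0, by simp⟩
    | succ n ih =>
      obtain ⟨w, hw⟩ := ih
      obtain ⟨w', hw'⟩ := hlin n
      refine ⟨w₀ + A w + w', ?_⟩
      rw [hw', hw, map_add, map_smul, hw₀]
      module
  have hsum : ∀ n : ℕ, ∃ w, K^[n] P = P + (2 : ℤ) ^ (e + 2) • ((n : ℤ) • b 0 + (4 : ℤ) • w) := by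
    intro n
    induction n with
    | zero => exact ⟨0, by simp⟩
    | succ n ih =>
      obtain ⟨w, hw⟩ := ih
      obtain ⟨w', hw'⟩ := hconst n
      refine ⟨w + w', ?_⟩
      rw [hb, hw, hw']
      push_cast
      module
  obtain ⟨w, hw⟩ := hsum s
  rw [hs] at hw
  have hzero : (s : ℤ) • b 0 + (4 : ℤ) • w = 0 := by
    refine two_pow_smul_cancel (e := e + 2) ?_
    rw [smul_zero]
    exact left_eq_add.1 hw
  have hab : b 0 = a := by
    refine two_pow_smul_cancel (e := e + 2) (add_left_cancel (a := P) ?_)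
    rw [← ha]; exact (hb 0).symm
  have hc := congrFun hzero i
  rw [hab] at hc
  simp only [Pi.add_apply, Pi.smul_apply, smul_eq_mul, Pi.zero_apply] at hc
  have hdvd : (4 : ℤ) ∣ s * a i := ⟨-w i, by linarith⟩
  have hcop : IsCoprime (4 : ℤ) (a i) := by
    have h2 : IsCoprime (2 : ℤ) (a i) := (Int.prime_two.coprime_iff_not_dvd).2 hi
    simpa using h2.pow_left (m := 2)
  exact_mod_cast hcop.dvd_of_dvd_mul_right hdvd

/-- If the linear part is idempotent modulo `4`, periodic points are fixed. -/
theorem fixed_of_periodic (hK : AffineModFour P A K) {W : Module.End ℤ (ι → ℤ)}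
    (hA : A * A = A + (4 : ℤ) • W) (hP : P ∈ Function.periodicPts K) : K P = P := by
  by_contra hne
  have hs := Function.iterate_minimalPeriod (f := K) (x := P)
  have hpos := Function.minimalPeriod_pos_of_mem_periodicPts hP
  obtain ⟨t, ht⟩ := hK.four_dvd_of_iterate_eq hA hne hs
  have hpow : ∀ n, ∃ Z, A ^ (n + 1) = A + (4 : ℤ) • Z := by
    intro n
    induction n with
    | zero => exact ⟨0, by simp⟩
    | succ n ih =>
      obtain ⟨Z, hZ⟩ := ih
      refine ⟨W + Z * A, ?_⟩
      rw [pow_succ, hZ, add_mul, hA, smul_mul_assoc]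
      module
  -- Half of the minimal period `4 * t`: this iterate moves `P` with period `2`, which `4` does not
  -- divide.
  obtain ⟨n, hn⟩ : ∃ n, 2 * t = n + 1 := ⟨2 * t - 1, by omega⟩
  obtain ⟨Z, hZ⟩ := hpow n
  have hK' : AffineModFour P A K^[n + 1] :=
    (hK.iterate (n + 1)).congr_linear (W := -Z) (by rw [hZ]; module)
  have hne' : K^[n + 1] P ≠ P := by
    intro h
    have := Function.IsPeriodicPt.minimalPeriod_le (f := K) (x := P) (n := n + 1) (by omega) h
    omega
  have h2 : (K^[n + 1])^[2] P = P := by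
    rw [← Function.iterate_mul, show (n + 1) * 2 = Function.minimalPeriod K P by omega, hs]
  have := hK'.four_dvd_of_iterate_eq hA hne' h2
  omega

end AffineModFour

/-! ### Arithmetic derivatives. -/

/-- `J` is a derivative of the self-map `F` in the arithmetic sense: first order Taylor expansions
hold along `c • u` with an error divisible by `c ^ 2`, and `J` respects congruences. -/
structure HasArithDeriv {V : Type*} [AddCommGroup V] (F : V → V) (J : V → Module.End ℤ V) :
    Prop where
  taylor : ∀ (x u : V) (c : ℤ), ∃ w, F (x + c • u) = F x + c • J x u + c ^ 2 • w
  congr : ∀ (x u : V) (c : ℤ), ∃ W, J (x + c • u) = J x + c • W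

namespace HasArithDeriv

variable {V : Type*} [AddCommGroup V] {F G : V → V} {J J' : V → Module.End ℤ V}

theorem comp (hF : HasArithDeriv F J) (hG : HasArithDeriv G J') :
    HasArithDeriv (F ∘ G) fun x => J (G x) * J' x := by
  refine ⟨fun x u c => ?_, fun x u c => ?_⟩
  · obtain ⟨w, hw⟩ := hG.taylor x u c
    obtain ⟨w', hw'⟩ := hF.taylor (G x) (J' x u + c • w) c
    refine ⟨J (G x) w + w', ?_⟩
    have e : G (x + c • u) = G x + c • (J' x u + c • w) := by rw [hw]; module
    simp only [Function.comp_apply, e, hw', map_add, map_smul, Module.End.mul_apply]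
    module
  · obtain ⟨w, hw⟩ := hG.taylor x u c
    obtain ⟨W, hW⟩ := hG.congr x u c
    obtain ⟨W', hW'⟩ := hF.congr (G x) (J' x u + c • w) c
    refine ⟨J (G x) * W + W' * J' x + c • (W' * W), ?_⟩
    have e : G (x + c • u) = G x + c • (J' x u + c • w) := by rw [hw]; module
    simp only [e, hW, hW', mul_add, add_mul, smul_mul_assoc, mul_smul_comm]
    module

theorem affineModFour (hG : HasArithDeriv G J) {P v : V} (hP : G P = P + (4 : ℤ) • v) :
    AffineModFour P (J P) G := by
  refine ⟨fun y => ?_, fun e y u => ?_⟩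
  · obtain ⟨w, hw⟩ := hG.taylor P y 4
    refine ⟨v + J P y + (4 : ℤ) • w, ?_⟩
    rw [hw, hP]
    module
  · obtain ⟨w, hw⟩ := hG.taylor (P + (4 : ℤ) • y) u (2 ^ (e + 2))
    obtain ⟨W, hW⟩ := hG.congr P y 4
    refine ⟨W u + (2 : ℤ) ^ e • w, ?_⟩
    rw [hw, hW]
    simp only [LinearMap.add_apply, LinearMap.smul_apply]
    module

/-- The orbit of `P` modulo `4` is governed by an affine map. -/
theorem apply_add_two_smul (hF : HasArithDeriv F J) {P a : V} (ha : F P = P + (2 : ℤ) • a)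
    (y : V) : ∃ w, F (P + (2 : ℤ) • y) = P + (2 : ℤ) • (a + J P y + (2 : ℤ) • w) := by
  obtain ⟨w, hw⟩ := hF.taylor P y 2
  refine ⟨w, ?_⟩
  rw [hw, ha]
  module

end HasArithDeriv

theorem mem_periodicPts_iterate {X : Type*} {g : X → X} {P : X} (hP : P ∈ Function.periodicPts g)
    (n : ℕ) : P ∈ Function.periodicPts g^[n] := by
  obtain ⟨s, hs, h⟩ := hP
  refine ⟨s, hs, ?_⟩
  have := h.const_mul n
  rwa [Function.IsPeriodicPt, Function.IsFixedPt, Function.iterate_mul] at this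

/-! ### Period bounds from the derivative modulo `2`. -/

namespace HasArithDeriv

variable {ι : Type*} {F G : (ι → ℤ) → ι → ℤ} {J : (ι → ℤ) → Module.End ℤ (ι → ℤ)} {P : ι → ℤ}

/-- If `P` is fixed modulo `4` and the derivative at `P` is idempotent modulo `2`, then the period
of `P` divides `2`. -/
theorem iterate_two_of_idempotent (hG : HasArithDeriv G J) {v : ι → ℤ}
    (hv : G P = P + (4 : ℤ) • v) {W : Module.End ℤ (ι → ℤ)} (hJ : J P * J P = J P + (2 : ℤ) • W)
    (hP : P ∈ Function.periodicPts G) : G^[2] P = P := by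
  refine ((hG.affineModFour hv).iterate 2).fixed_of_periodic (W := J P * W + W * W) ?_
    (mem_periodicPts_iterate hP 2)
  have hW : (2 : ℤ) • W = J P * J P - J P := by rw [hJ]; abel
  -- `2 • W` is a polynomial in `J P`, so the two cross terms of the square add up to a multiple of
  -- `4`.
  have hcomm : (2 : ℤ) • (W * J P) = (2 : ℤ) • (J P * W) := by
    rw [← smul_mul_assoc, ← mul_smul_comm, hW]; noncomm_ring
  calc J P ^ 2 * J P ^ 2 = (J P + (2 : ℤ) • W) * (J P + (2 : ℤ) • W) := by rw [pow_two, hJ]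
    _ = J P * J P + (2 : ℤ) • (J P * W) + (2 : ℤ) • (W * J P) + (4 : ℤ) • (W * W) := by
      noncomm_ring
    _ = J P ^ 2 + (4 : ℤ) • (J P * W + W * W) := by rw [hcomm, pow_two]; module

/-- The case of a derivative whose unit part is trivial modulo `2`. -/
theorem iterate_four_of_cube_eq_sq (hF : HasArithDeriv F J) {a : ι → ℤ}
    (ha : F P = P + (2 : ℤ) • a) {W : Module.End ℤ (ι → ℤ)}
    (hJ : J P * J P * J P = J P * J P + (2 : ℤ) • W) (hP : P ∈ Function.periodicPts F) :
    F^[4] P = P := by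
  set A := J P with hA
  have hcube : ∀ x, A (A (A x)) = A (A x) + (2 : ℤ) • W x := fun x => by
    simpa using LinearMap.congr_fun hJ x
  have horb : ∀ n : ℕ, ∃ w, F^[n + 2] P =
      P + (2 : ℤ) • (a + A a + (n : ℤ) • A (A a) + (2 : ℤ) • w) := by
    intro n
    induction n with
    | zero =>
      obtain ⟨w, hw⟩ := hF.apply_add_two_smul ha a
      refine ⟨w, ?_⟩
      simp only [zero_add, Function.iterate_succ_apply', Function.iterate_zero, id_eq, ha, hw]
      module
    | succ n ih =>
      obtain ⟨w, hw⟩ := ih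
      obtain ⟨w', hw'⟩ := hF.apply_add_two_smul ha (a + A a + (n : ℤ) • A (A a) + (2 : ℤ) • w)
      refine ⟨(n : ℤ) • W a + A w + w', ?_⟩
      rw [show n + 1 + 2 = n + 2 + 1 by ring, Function.iterate_succ_apply', hw, hw', ← hA]
      simp only [map_add, map_smul, hcube]
      push_cast
      module
  -- Going round the cycle twice makes the coefficient `2 * r` of `A (A a)` even, leaving `a + A a`
  -- even.
  have hsq : ∃ v, (F ∘ F) P = P + (4 : ℤ) • v := by
    obtain ⟨s, hs, h⟩ := hP
    obtain ⟨r, rfl⟩ := Nat.exists_eq_succ_of_ne_zero hs.ne'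
    obtain ⟨w, hw⟩ := horb (2 * r)
    obtain ⟨w', hw'⟩ := horb 0
    have h2 : F^[2 * r + 2] P = P := h.const_mul 2
    rw [h2, left_eq_add, smul_eq_zero_iff_right two_ne_zero] at hw
    refine ⟨w' - (r : ℤ) • A (A a) - w, ?_⟩
    change F^[0 + 2] P = _
    have e : a + A a = -((2 * r : ℕ) : ℤ) • A (A a) - (2 : ℤ) • w := by
      rw [← sub_eq_zero, ← hw]; module
    rw [hw', e]
    push_cast
    module
  obtain ⟨v, hv⟩ := hsq
  obtain ⟨Z, hZ⟩ := hF.congr P a 2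
  have h2 := (hF.comp hF).iterate_two_of_idempotent hv
    (W := W * A + W + (A * A * Z * A + Z * A * A * A + (2 : ℤ) • (Z * A * Z * A) - Z * A)) ?_
    (mem_periodicPts_iterate hP 2)
  · exact h2
  · rw [ha, hZ, ← hA]
    have h4 : A * A * A * A = A * A + (2 : ℤ) • (W * A + W) := by
      rw [hJ, add_mul, hJ]; noncomm_ring
    calc (A + (2 : ℤ) • Z) * A * ((A + (2 : ℤ) • Z) * A) = A * A * A * A +
          (2 : ℤ) • (A * A * Z * A + Z * A * A * A + (2 : ℤ) • (Z * A * Z * A)) := by noncomm_ring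
      _ = _ := by rw [h4]; noncomm_ring

/-- The case of a derivative of order `3` modulo `2`. -/
theorem iterate_six_of_order_three (hF : HasArithDeriv F J) {a : ι → ℤ}
    (ha : F P = P + (2 : ℤ) • a) {W : Module.End ℤ (ι → ℤ)}
    (hJ : J P * J P + J P + 1 = (2 : ℤ) • W) (hP : P ∈ Function.periodicPts F) :
    F^[6] P = P := by
  set A := J P with hA
  have hquad : ∀ x, A (A x) + A x + x = (2 : ℤ) • W x := fun x => by
    simpa using LinearMap.congr_fun hJ x
  obtain ⟨w₁, h₁⟩ := hF.apply_add_two_smul ha a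
  obtain ⟨w₂, h₂⟩ := hF.apply_add_two_smul ha (a + A a + (2 : ℤ) • w₁)
  rw [← hA] at h₁ h₂
  have hv : (F ∘ F ∘ F) P = P + (4 : ℤ) • (W a + A w₁ + w₂) := by
    simp only [Function.comp_apply, ha, h₁, h₂, map_add, map_smul]
    rw [show a + (A a + A (A a) + (2 : ℤ) • A w₁) + (2 : ℤ) • w₂ =
      (A (A a) + A a + a) + (2 : ℤ) • (A w₁ + w₂) by module, hquad]
    module
  obtain ⟨Z₁, hZ₁⟩ := hF.congr P a 2
  obtain ⟨Z₂, hZ₂⟩ := hF.congr P (a + A a + (2 : ℤ) • w₁) 2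
  have hcub : A * A * A = 1 + (2 : ℤ) • (A * W - W) := by
    have : A * A * A = 1 + (A * (A * A + A + 1) - (A * A + A + 1)) := by noncomm_ring
    rw [this, hJ]; noncomm_ring
  have hone : ∃ U, J ((F ∘ F) P) * (J (F P) * J P) = 1 + (2 : ℤ) • U := by
    refine ⟨A * W - W + Z₂ * A * A + A * Z₁ * A + (2 : ℤ) • (Z₂ * Z₁ * A), ?_⟩
    simp only [Function.comp_apply, ha, h₁, hZ₁, hZ₂, ← hA]
    rw [smul_add, smul_add, smul_add, ← add_assoc, ← add_assoc, ← add_assoc, ← hcub]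
    noncomm_ring
  obtain ⟨U, hU⟩ := hone
  exact (hF.comp (hF.comp hF)).iterate_two_of_idempotent hv (W := U + (2 : ℤ) • (U * U))
    (by simp only [Function.comp_apply] at hU ⊢; rw [hU]; noncomm_ring)
    (mem_periodicPts_iterate hP 3)

end HasArithDeriv

/-! ### The involution case. -/

/-- The signed area spanned by two vectors of `ℤ ^ 2`. -/
def area (y u : Fin 2 → ℤ) : ℤ := y 0 * u 1 - y 1 * u 0

theorem area_add_left (x y u : Fin 2 → ℤ) : area (x + y) u = area x u + area y u := by
  simp [area]; ring

theorem area_add_right (x y u : Fin 2 → ℤ) : area x (y + u) = area x y + area x u := by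
  simp [area]; ring

theorem area_smul_left (c : ℤ) (y u : Fin 2 → ℤ) : area (c • y) u = c * area y u := by
  simp [area]; ring

theorem area_smul_right (c : ℤ) (y u : Fin 2 → ℤ) : area y (c • u) = c * area y u := by
  simp [area]; ring

namespace HasArithDeriv

variable {F : (Fin 2 → ℤ) → Fin 2 → ℤ} {J : (Fin 2 → ℤ) → Module.End ℤ (Fin 2 → ℤ)}
  {P : Fin 2 → ℤ}

/-- The case of a derivative that is an involution modulo `2`. The second derivative enters through
`hb`: modulo `2` it is an alternating form with values in the line spanned by `b`. -/
theorem iterate_four_of_involution (hF : HasArithDeriv F J) {a b : Fin 2 → ℤ}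
    (ha : F P = P + (2 : ℤ) • a)
    (hb : ∀ y u, ∃ w, J (P + (2 : ℤ) • y) u = J P u + (2 : ℤ) • (area y u • b) + (4 : ℤ) • w)
    {d : ℤ} (hd : ∀ y u, area (J P y) (J P u) = (2 * d + 1) * area y u)
    {W : Module.End ℤ (Fin 2 → ℤ)} (hJ : J P * J P = 1 + (2 : ℤ) • W)
    (hP : P ∈ Function.periodicPts F) : F^[4] P = P := by
  set A := J P with hA
  have hinv : ∀ x, A (A x) = x + (2 : ℤ) • W x := fun x => by
    simpa using LinearMap.congr_fun hJ x
  obtain ⟨w₁, h₁⟩ := hF.apply_add_two_smul ha a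
  rw [← hA] at h₁
  set y := a + A a + (2 : ℤ) • w₁ with hy
  obtain ⟨w₂, h₂⟩ := hF.apply_add_two_smul ha y
  rw [← hA] at h₂
  set z := a + A y + (2 : ℤ) • w₂ with hz
  obtain ⟨w₃, h₃⟩ := hF.apply_add_two_smul ha z
  rw [← hA] at h₃
  have hAy : A y = y + (2 : ℤ) • (W a + A w₁ - w₁) := by
    rw [hy]; simp only [map_add, map_smul, hinv]; module
  have hz' : z = a + y + (2 : ℤ) • (W a + A w₁ - w₁ + w₂) := by
    rw [hz, hAy]; module
  have hv : ∃ v, (F ∘ F ∘ F ∘ F) P = P + (4 : ℤ) • v := by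
    refine ⟨y - w₁ + (W a + A w₁ - w₁) + A (W a + A w₁ - w₁ + w₂) + w₃, ?_⟩
    simp only [Function.comp_apply, ha, h₁, h₂, h₃]
    rw [hz', map_add, map_add, map_smul, hAy, show a + (A a + (y + (2 : ℤ) • (W a + A w₁ - w₁)) +
      (2 : ℤ) • A (W a + A w₁ - w₁ + w₂)) + (2 : ℤ) • w₃ =
      (a + A a + (2 : ℤ) • w₁) + y + (2 : ℤ) • ((W a + A w₁ - w₁) +
       A (W a + A w₁ - w₁ + w₂) + w₃ - w₁) by module, ← hy]
    module
  obtain ⟨v, hv⟩ := hv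
  have hcomp := hF.comp (hF.comp (hF.comp hF))
  -- Modulo `2`, `z` is `a + y` and `A` fixes `y`, so the `area a (A u)` terms from the factors at
  -- `a` and `z` cancel.
  have hderiv : ∀ u, ∃ w, (J ((F ∘ F ∘ F) P) * (J ((F ∘ F) P) * (J (F P) * J P))) u =
      u + (2 : ℤ) • (area y u • (A b + b)) + (4 : ℤ) • w := by
    intro u
    obtain ⟨c₁, hc₁⟩ := hb a (A u)
    set m₁ := W u + area a (A u) • b + (2 : ℤ) • c₁ with hm₁
    have e₁ : J (P + (2 : ℤ) • a) (A u) = u + (2 : ℤ) • m₁ := by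
      rw [hc₁, hinv, hm₁]; module
    obtain ⟨c₂, hc₂⟩ := hb y (u + (2 : ℤ) • m₁)
    set m₂ := A m₁ + area y u • b + (2 : ℤ) • (area y m₁ • b + c₂) with hm₂
    have e₂ : J (P + (2 : ℤ) • y) (u + (2 : ℤ) • m₁) = A u + (2 : ℤ) • m₂ := by
      rw [hc₂, hm₂, map_add, map_smul, area_add_right, area_smul_right]; module
    obtain ⟨c₃, hc₃⟩ := hb z (A u + (2 : ℤ) • m₂)
    have hzu : area z (A u) = area a (A u) + (2 * d + 1) * area y u +
        2 * (area w₂ (A u)) := by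
      rw [hz, area_add_left, area_add_left, area_smul_left, hd]
    refine ⟨W u + c₁ + W m₁ + A (area y m₁ • b + c₂) +
      (area a (A u) + d * area y u + area w₂ (A u) + area z m₂) • b + c₃, ?_⟩
    simp only [Function.comp_apply, Module.End.mul_apply, ha, h₁, h₂, ← hA, e₁, e₂, hc₃]
    rw [area_add_right, area_smul_right, hzu, map_add, map_smul, hinv, hm₂]
    simp only [map_add, map_smul, hinv]
    rw [hm₁]
    module
  have hidem : ∃ U, J ((F ∘ F ∘ F) P) * (J ((F ∘ F) P) * (J (F P) * J P)) = 1 + (2 : ℤ) • U := by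
    obtain ⟨Z₁, hZ₁⟩ := hF.congr P a 2
    obtain ⟨Z₂, hZ₂⟩ := hF.congr P y 2
    obtain ⟨Z₃, hZ₃⟩ := hF.congr P z 2
    have h4 : A * (A * (A * A)) = 1 + (4 : ℤ) • (W + W * W) := by
      rw [hJ, ← mul_assoc, hJ]; noncomm_ring
    refine ⟨(2 : ℤ) • (W + W * W) + Z₃ * (J ((F ∘ F) P) * (J (F P) * A)) +
      A * (Z₂ * (J (F P) * A)) + A * (A * (Z₁ * A)), ?_⟩
    simp only [Function.comp_apply, ha, h₁, h₂, hZ₁, hZ₂, hZ₃, ← hA]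
    calc _ = A * (A * (A * A)) + (2 : ℤ) • (Z₃ * ((A + (2 : ℤ) • Z₂) * ((A + (2 : ℤ) • Z₁) * A)) +
          A * (Z₂ * ((A + (2 : ℤ) • Z₁) * A)) + A * (A * (Z₁ * A))) := by noncomm_ring
      _ = _ := by rw [h4]; module
  obtain ⟨U, hU⟩ := hidem
  have hG2 := hcomp.iterate_two_of_idempotent hv (W := U + (2 : ℤ) • (U * U))
    (by simp only [Function.comp_apply] at hU ⊢; rw [hU]; noncomm_ring)
    (mem_periodicPts_iterate hP 4)
  by_contra hne
  have hG := hcomp.affineModFour hv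
  obtain ⟨e, u, hu, i, hi⟩ := hG.exists_displacement hne
  obtain ⟨w, hw⟩ := hG.2 e 0 u
  obtain ⟨w', hw'⟩ := hderiv u
  rw [smul_zero, add_zero, ← hu] at hw
  have hGG : (F ∘ F ∘ F ∘ F) ((F ∘ F ∘ F ∘ F) P) = P := hG2
  rw [hGG, hw', hu, add_assoc, left_eq_add, ← smul_add,
    smul_eq_zero_iff_right (pow_ne_zero _ two_ne_zero)] at hw
  -- The two displacements along the 2-cycle of `F^4` sum to zero.
  have hu2 : u = -(area y u • (A b + b)) - (2 : ℤ) • (w + w') := by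
    refine two_pow_smul_cancel (e := 1) ?_
    rw [← sub_eq_zero, ← hw]
    module
  set q := W a + A w₁ - w₁
  have hyAb : area y (A b) + 2 * area q (A b) = (2 * d + 1) * area y b := by
    rw [← hd, hAy, area_add_left y, area_smul_left]
  -- Pairing with `y` kills `A b + b` modulo `2`, as `A` fixes `y` and preserves `area` there; hence
  -- `area y u`, and then `u`, is even.
  have hyu : area y u = -(area y u * (area y (A b) + area y b)) - 2 * area y (w + w') := by
    conv_lhs => rw [hu2]
    simp only [area, Pi.sub_apply, Pi.neg_apply, Pi.add_apply, Pi.smul_apply, smul_eq_mul]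
    ring
  have heven : area y u = 2 * -(area y u * (d * area y b + area y b - area q (A b)) +
      area y (w + w')) := by
    rw [eq_sub_of_add_eq hyAb] at hyu
    linarith
  refine hi ?_
  rw [hu2, heven]
  exact ⟨(area y u * (d * area y b + area y b - area q (A b)) + area y (w + w')) * (A b + b) i -
    (w + w') i, by
      simp only [Pi.sub_apply, Pi.neg_apply, Pi.smul_apply, smul_eq_mul]; ring⟩

end HasArithDeriv

/-! ### Polynomial Taylor expansions and Jacobians. -/

open MvPolynomial in
theorem MvPolynomial.exists_eval_add_smul {σ R : Type*} [CommRing R] [Fintype σ]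
    (p : MvPolynomial σ R) (x u : σ → R) (c : R) : ∃ w, eval (x + c • u) p =
      eval x p + c * ∑ j, eval x (pderiv j p) * u j + c ^ 2 * w := by
  classical
  induction p using MvPolynomial.induction_on with
  | C r => exact ⟨0, by simp⟩
  | add p q hp hq =>
    obtain ⟨w, hw⟩ := hp
    obtain ⟨w', hw'⟩ := hq
    refine ⟨w + w', ?_⟩
    simp only [map_add, hw, hw', add_mul, Finset.sum_add_distrib]
    ring
  | mul_X p i hp =>
    obtain ⟨w, hw⟩ := hp
    refine ⟨w * (x i + c * u i) + (∑ j, eval x (pderiv j p) * u j) * u i, ?_⟩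
    have e : ∑ j, eval x (pderiv j (p * X i)) * u j =
        (∑ j, eval x (pderiv j p) * u j) * x i + eval x p * u i := by
      simp only [pderiv_mul, pderiv_X, map_add, map_mul, eval_X, add_mul, Finset.sum_add_distrib,
        Finset.sum_mul]
      congr 1
      · exact Finset.sum_congr rfl fun j _ => by ring
      · rw [Finset.sum_eq_single i]
        · simp
        · intro j _ hj; simp [hj.symm]
        · simp
    rw [e]
    simp only [map_mul, hw, eval_X, Pi.add_apply, Pi.smul_apply, smul_eq_mul]
    ring

-- Comes from `n * (n - 1)` being even; it makes the Hessian modulo `2` alternating.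
open MvPolynomial in
theorem MvPolynomial.two_dvd_pderiv_pderiv_self {σ R : Type*} [CommRing R]
    (p : MvPolynomial σ R) (i : σ) : 2 ∣ pderiv i (pderiv i p) := by
  classical
  induction p using MvPolynomial.induction_on with
  | C r => simp
  | add p q hp hq => rw [map_add, map_add]; exact dvd_add hp hq
  | mul_X p j hp =>
    have e : pderiv i (pderiv i (p * X j)) =
        pderiv i (pderiv i p) * X j + 2 * (pderiv i p * pderiv i (X j)) := by
      rcases eq_or_ne i j with rfl | h
      · simp only [pderiv_mul, pderiv_X_self, map_add, pderiv_one]; ring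
      · simp only [pderiv_mul, pderiv_X_of_ne h.symm, map_add, map_zero]; ring
    rw [e]
    exact dvd_add (hp.mul_right _) (dvd_mul_right _ _)

open MvPolynomial in
theorem MvPolynomial.pderiv_pderiv_comm {σ R : Type*} [CommRing R]
    (p : MvPolynomial σ R) (i j : σ) : pderiv i (pderiv j p) = pderiv j (pderiv i p) := by
  classical
  induction p using MvPolynomial.induction_on with
  | C r => simp
  | add p q hp hq => simp only [map_add, hp, hq]
  | mul_X p k hp =>
    have hX : ∀ l m : σ, pderiv l (pderiv m (X k : MvPolynomial σ R)) = 0 := by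
      intro l m
      rcases eq_or_ne k m with rfl | h
      · simp
      · simp [pderiv_X_of_ne h]
    simp only [pderiv_mul, map_add, hp, hX]
    ring

namespace AffineEndo

open MvPolynomial

/-- The Jacobian of an endomorphism of affine space, as an endomorphism of the tangent space. -/
noncomputable def jacobian {N : ℕ} (f : AffineEndo N ℤ) (x : Fin N → ℤ) :
    Module.End ℤ (Fin N → ℤ) :=
  Matrix.mulVecLin (Matrix.of fun i j => eval x (pderiv j (f i)))

theorem jacobian_apply {N : ℕ} (f : AffineEndo N ℤ) (x u : Fin N → ℤ) (i : Fin N) :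
    f.jacobian x u i = ∑ j, eval x (pderiv j (f i)) * u j := by
  simp [jacobian, Matrix.mulVec, dotProduct]

theorem hasArithDeriv {N : ℕ} (f : AffineEndo N ℤ) : HasArithDeriv f.onPoints f.jacobian := by
  refine ⟨fun x u c => ?_, fun x u c => ?_⟩
  · choose w hw using fun i => (f i).exists_eval_add_smul x u c
    refine ⟨w, funext fun i => ?_⟩
    simp only [onPoints, Pi.add_apply, Pi.smul_apply, smul_eq_mul, jacobian_apply]
    exact hw i
  · choose w hw using fun i j => (pderiv j (f i)).exists_eval_add_smul x u c
    refine ⟨Matrix.mulVecLin (Matrix.of fun i j =>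
      (∑ k, eval x (pderiv k (pderiv j (f i))) * u k) + c * w i j), ?_⟩
    refine LinearMap.ext fun v => funext fun i => ?_
    simp only [LinearMap.add_apply, LinearMap.smul_apply, Pi.add_apply, Pi.smul_apply,
      jacobian_apply, hw, smul_eq_mul, Matrix.mulVecLin_apply, Matrix.mulVec, dotProduct,
      Matrix.of_apply]
    rw [Finset.mul_sum, ← Finset.sum_add_distrib]
    exact Finset.sum_congr rfl fun j _ => by ring

/-- In dimension two, the Jacobian modulo `4` varies by an alternating form. -/
theorem exists_jacobian_add_two_smul (f : AffineEndo 2 ℤ) (x : Fin 2 → ℤ) : ∃ b : Fin 2 → ℤ,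
    ∀ y u, ∃ w, f.jacobian (x + (2 : ℤ) • y) u =
      f.jacobian x u + (2 : ℤ) • (area y u • b) + (4 : ℤ) • w := by
  choose r hr using fun i j => (f i).two_dvd_pderiv_pderiv_self j
  refine ⟨fun i => eval x (pderiv 0 (pderiv 1 (f i))), fun y u => ?_⟩
  choose w hw using fun i j => (pderiv j (f i)).exists_eval_add_smul x y 2
  refine ⟨fun i => (eval x (r i 0) * y 0 + w i 0) * u 0 +
    (eval x (r i 1) * y 1 + w i 1) * u 1 +
    eval x (pderiv 0 (pderiv 1 (f i))) * y 1 * u 0, funext fun i => ?_⟩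
  simp only [jacobian_apply, hw, Fin.sum_univ_two, Pi.add_apply, Pi.smul_apply, smul_eq_mul, hr,
    (f i).pderiv_pderiv_comm 1 0, map_mul, map_ofNat, area]
  ring

/-- Iterates of the self-map of an endomorphism are given by endomorphisms. -/
theorem exists_onPoints_eq_iterate {N : ℕ} {R : Type*} [CommRing R] (f : AffineEndo N R) (m : ℕ) :
    ∃ g : AffineEndo N R, g.onPoints = f.onPoints^[m] := by
  induction m with
  | zero => exact ⟨X, by funext P i; simp [onPoints]⟩
  | succ m ih =>
    obtain ⟨g, hg⟩ := ih
    refine ⟨fun i => bind₁ g (f i), ?_⟩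
    rw [Function.iterate_succ', ← hg]
    funext P i
    exact eval₂Hom_bind₁ _ _ _ _

theorem jacobian_mul_self (f : AffineEndo 2 ℤ) (x : Fin 2 → ℤ) : ∃ t d : ℤ,
    f.jacobian x * f.jacobian x = t • f.jacobian x - d • 1 ∧
      ∀ y u, area (f.jacobian x y) (f.jacobian x u) = d * area y u := by
  set M : Matrix (Fin 2) (Fin 2) ℤ := Matrix.of fun i j => eval x (pderiv j (f i)) with hM
  refine ⟨M 0 0 + M 1 1, M 0 0 * M 1 1 - M 0 1 * M 1 0, ?_, fun y u => ?_⟩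
  · refine LinearMap.ext fun v => funext fun i => ?_
    change (M.mulVec (M.mulVec v)) i =
      (M 0 0 + M 1 1) * (M.mulVec v) i - (M 0 0 * M 1 1 - M 0 1 * M 1 0) * v i
    fin_cases i <;> simp [Matrix.mulVec, dotProduct, Fin.sum_univ_two] <;> ring
  · change area (M.mulVec y) (M.mulVec u) = _
    simp [area, Matrix.mulVec, dotProduct, Fin.sum_univ_two]
    ring

end AffineEndo

/-! ### Case division and the final count. -/

namespace AffineEndo

/-- A periodic point that is fixed modulo `2` has period dividing `4` or `6`. -/
theorem iterate_four_or_six (f : AffineEndo 2 ℤ) {P a : Fin 2 → ℤ}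
    (ha : f.onPoints P = P + (2 : ℤ) • a) (hP : P ∈ Function.periodicPts f.onPoints) :
    f.onPoints^[4] P = P ∨ f.onPoints^[6] P = P := by
  have hf := f.hasArithDeriv
  obtain ⟨t, d, hJ, hd⟩ := f.jacobian_mul_self P
  obtain ⟨k, hk⟩ := Int.even_or_odd' t
  obtain ⟨l, hl⟩ := Int.even_or_odd' d
  set A := f.jacobian P with hA
  -- Modulo `2` the four cases read `A^2 = 0`, `A^2 = 1`, `A^2 = A` and `A^2 = A + 1`.
  rcases hk with rfl | rfl <;> rcases hl with rfl | rfl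
  · have hJ' : A * A = (2 : ℤ) • (k • A - l • 1) := by rw [hJ]; module
    refine .inl (hf.iterate_four_of_cube_eq_sq ha (W := (k • A - l • 1) * A - (k • A - l • 1))
      ?_ hP)
    rw [← hA, hJ']; noncomm_ring
  · obtain ⟨b, hb⟩ := f.exists_jacobian_add_two_smul P
    refine .inl (hf.iterate_four_of_involution ha hb hd (W := k • A - (l + 1) • 1) ?_ hP)
    rw [← hA, hJ]; module
  · have hJ' : A * A = A + (2 : ℤ) • (k • A - l • 1) := by rw [hJ]; module
    refine .inl (hf.iterate_four_of_cube_eq_sq ha (W := (k • A - l • 1) * A) ?_ hP)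
    rw [← hA]
    nth_rewrite 1 [hJ']
    noncomm_ring
  · refine .inr (hf.iterate_six_of_order_three ha (W := (k + 1) • A - l • 1) ?_ hP)
    rw [← hA, hJ]; module

/-- A periodic point returns to its residue class modulo `2` within four steps. -/
theorem exists_iterate_congr_two (f : AffineEndo 2 ℤ) {P : Fin 2 → ℤ}
    (hP : P ∈ Function.periodicPts f.onPoints) :
    ∃ m, 0 < m ∧ m ≤ 4 ∧ ∃ a, f.onPoints^[m] P = P + (2 : ℤ) • a := by
  let res : (Fin 2 → ℤ) → Fin 2 → ZMod 2 := fun x i => (x i : ZMod 2)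
  have hres : ∀ x y, res x = res y → ∃ a, x = y + (2 : ℤ) • a := by
    intro x y h
    have hdvd : ∀ i, (2 : ℤ) ∣ x i - y i := fun i => by
      have := congrFun h i
      rw [← Int.modEq_iff_dvd]
      exact ((ZMod.intCast_eq_intCast_iff _ _ 2).1 this).symm
    choose a ha using hdvd
    exact ⟨a, funext fun i => by simp [← ha i]⟩
  obtain ⟨i, j, hne, hij⟩ := Fintype.exists_ne_map_eq_of_card_lt
    (fun i : Fin 5 => res (f.onPoints^[(i : ℕ)] P)) (by simp)
  wlog hlt : i < j generalizing i j
  · exact this j i hne.symm hij.symm (lt_of_le_of_ne (not_lt.1 hlt) hne.symm)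
  have hlt' : (i : ℕ) < j := hlt
  obtain ⟨a, ha⟩ := hres _ _ hij.symm
  obtain ⟨s, hs, hper⟩ := hP
  -- This iterate carries `f^i P` back to `P` and respects congruence modulo `2`, moving the
  -- collision to `P`.
  obtain ⟨g, hg⟩ := f.exists_onPoints_eq_iterate (s * i - i)
  obtain ⟨w, hw⟩ := g.hasArithDeriv.taylor (f.onPoints^[(i : ℕ)] P) a 2
  have hle : (i : ℕ) ≤ s * i := Nat.le_mul_of_pos_left _ hs
  have hback : f.onPoints^[s * i] P = P := hper.mul_const i
  rw [← ha, hg, ← Function.iterate_add_apply, ← Function.iterate_add_apply,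
    Nat.sub_add_cancel hle, hback, show s * (i : ℕ) - i + j = (j - i) + s * i by omega,
    Function.iterate_add_apply, hback] at hw
  refine ⟨j - i, by omega, by omega,
    g.jacobian (f.onPoints^[(i : ℕ)] P) a + (2 : ℤ) • w, hw.trans ?_⟩
  module

end AffineEndo

theorem forwardOrbit_encard_le {X : Type*} {g : X → X} {P : X} {n : ℕ} (hn : 0 < n)
    (h : g^[n] P = P) : (forwardOrbit g P).encard ≤ n := by
  have hsub : forwardOrbit g P ⊆ (Finset.range n : Set ℕ).image fun k => g^[k] P := by
    rintro _ ⟨k, rfl⟩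
    exact ⟨k % n, by simpa using Nat.mod_lt k hn, Function.IsPeriodicPt.iterate_mod_apply h k⟩
  calc (forwardOrbit g P).encard ≤ _ := Set.encard_le_encard hsub
    _ ≤ (Finset.range n : Set ℕ).encard := Set.encard_image_le _ _
    _ = n := by rw [Set.encard_coe_eq_coe_finsetCard, Finset.card_range]

theorem theorem1p2 (f : AffineEndo 2 ℤ) (P : Fin 2 → ℤ)
    (hP : P ∈ Function.periodicPts f.onPoints) :
    (forwardOrbit f.onPoints P).encard ≤ 24 := by
  obtain ⟨m, hm, hm4, a, ha⟩ := f.exists_iterate_congr_two hP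
  obtain ⟨g, hg⟩ := f.exists_onPoints_eq_iterate m
  have hcase : ∃ k, 0 < k ∧ k ≤ 6 ∧ g.onPoints^[k] P = P := by
    rcases g.iterate_four_or_six (hg ▸ ha) (hg ▸ mem_periodicPts_iterate hP m) with h | h
    · exact ⟨4, by norm_num, by norm_num, h⟩
    · exact ⟨6, by norm_num, le_rfl, h⟩
  obtain ⟨k, hk, hk6, h⟩ := hcase
  rw [hg, ← Function.iterate_mul] at h
  refine (forwardOrbit_encard_le (Nat.mul_pos hm hk) h).trans ?_
  exact_mod_cast Nat.mul_le_mul hm4 hk6
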